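/- Let $K$ be an algebraically closed field of characteristic $p\ge 0$. For $f,g\in K[[x,y]]$ let $i_0(f,g)=\dim_K K[[x,y]]/(f,g)$ be the intersection number and $\mu(f)=\dim_K K[[x,y]]/\left(\frac{\partial f}{\partial x},\frac{\partial f}{\partial y}\right)$ the Milnor number, both in $\mathbb{N}\cup\{\infty\}$. Here $n\not\equiv 0 \pmod p$ means that $n$ is finite and not divisible by $p$ (for $p=0$: finite and nonzero), and $\infty+n=\infty-1=\infty$. Let $f\in K[[x,y]]$ be a reduced power series (nonzero and without multiple irreducible factors), let $l\in K[[x,y]]$ be a regular parameter (a power series of order $1$) that does not divide $f$, and let $$\mathcal P_l(f)=\frac{\partial f}{\partial x}\frac{\partial l}{\partial y}-\frac{\partial f}{\partial y}\frac{\partial l}{\partial x}$$ be the polar of $f$ with respect to $l$. Suppose that (i) $i_0(f,l)\not\equiv 0\pmod p$, and (ii) $i_0(l,h)\not\equiv 0\pmod p$ for every irreducible factor $h$ of $\mathcal P_l(f)$. Then $$i_0(f,\mathcal P_l(f))\le \mu(f)+i_0(f,l)-1,$$ with equality if and only if (iii) $i_0(f,h)\not\equiv 0\pmod p$ for every irreducible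 factor $h$ of $\mathcal P_l(f)$. -/

import Mathlib

namespace PlaneCurve

/-- The ring `K[[x,y]]` of formal power series in two variables; `x` is the variable of index `0`
and `y` the variable of index `1`. -/
abbrev Ring2 (K : Type*) : Type _ := MvPowerSeries (Fin 2) K

/-- The formal partial derivative with respect to `x`. -/
noncomputable def dx {K : Type*} [Field K] (f : Ring2 K) : Ring2 K :=
  MvPowerSeries.pderiv K (0 : Fin 2) f

/-- The formal partial derivative with respect to `y`. -/
noncomputable def dy {K : Type*} [Field K] (f : Ring2 K) : Ring2 K :=
  MvPowerSeries.pderiv K (1 : Fin 2) f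

/-- The intersection number `i₀(f,g) = dim_K K[[x,y]]/(f,g)`, in `ℕ∞`
(every infinite dimension is `⊤`). -/
noncomputable def intersectionNumber {K : Type*} [Field K] (f g : Ring2 K) : ℕ∞ :=
  Cardinal.toENat (Module.rank K (Ring2 K ⧸ Ideal.span ({f, g} : Set (Ring2 K))))

/-- The Milnor number `μ(f) = dim_K K[[x,y]]/(∂f/∂x, ∂f/∂y)`, in `ℕ∞`. -/
noncomputable def milnorNumber {K : Type*} [Field K] (f : Ring2 K) : ℕ∞ :=
  Cardinal.toENat (Module.rank K (Ring2 K ⧸ Ideal.span ({dx f, dy f} : Set (Ring2 K))))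

/-- A regular parameter is a power series of order one. -/
def IsRegularParameter {K : Type*} [Field K] (l : Ring2 K) : Prop :=
  MvPowerSeries.order l = 1

/-- The polar `P_l(f) = (∂f/∂x)(∂l/∂y) - (∂f/∂y)(∂l/∂x)` of `f` with respect to `l`. -/
noncomputable def polar {K : Type*} [Field K] (l f : Ring2 K) : Ring2 K :=
  dx f * dy l - dy f * dx l

/-- `n ≢ 0 (mod p)`: `n` is an integer (i.e. not `∞`) that is not congruent to `0` modulo `p`.
For `p = 0` this means that `n` is finite and nonzero. -/
def NotCongrZero (p : ℕ) (n : ℕ∞) : Prop :=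
  ∃ m : ℕ, n = (m : ℕ∞) ∧ ¬ m ≡ 0 [MOD p]

end PlaneCurve

/-! Write P for the polar. Some partial derivative w of f satisfies (f_x, f_y) = (w, P), so μ(f) =
i₀(w, P) (`exists_partial`), and (i) gives i₀(f, l) - 1 = i₀(l, P)
(`intersectionNumber_polar_add_one`). By additivity over the prime factors h of P, the claim reduces
to comparing i₀(f, h) with i₀(w, h) + i₀(l, h) for each h (`intersectionNumber_le_of_dvd_polar`).
The i₀(f, h) are finite (`not_dvd_of_dvd_polar`), so the sums agree only if all terms do.

Along a parametrization γ of h = 0 the gradients of f and l are proportional, so (γ f)' = γ(w) (γ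
l)' up to a unit. Differentiation lowers an order by exactly one when p does not divide it, and does
not lower it otherwise. Hypothesis (ii) settles γ l; for γ f this dichotomy is the inequality
together with condition (iii).

The parametrization (`exists_parametrization`) must satisfy ord γ(g) = r i₀(g, h) with p ∤ r. The
ring A = K[[x,y]]/(h) is finite of rank n = i₀(l, h) over K[[X]], X acting as l. As p ∤ n, the
extension of fraction fields is separable and the normalization of A is finite. Ramification indices
times residue degrees sum to n, so some index e is prime to p; expansion in a uniformizer there
gives γ. If r is the rank of the target over A, then e = r n, so p ∤ r. Neither r = 1 nor uniqueness
of the point is needed. -/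

namespace PlaneCurve

/-- The dimension of a vector space as an element of `ℕ∞`. -/
noncomputable def vdim (K V : Type*) [Field K] [AddCommGroup V] [Module K V] : ℕ∞ :=
  Cardinal.toENat (Module.rank K V)

/-! ### Dimensions of cokernels -/

section LinearAlgebra

variable {K : Type*} [Field K]

theorem vdim_congr {V W : Type*} [AddCommGroup V] [Module K V] [AddCommGroup W]
    [Module K W] (e : V ≃ₗ[K] W) : vdim K V = vdim K W := by
  have h := e.lift_rank_eq
  apply_fun Cardinal.toENat at h
  simpa [vdim] using h

theorem vdim_eq_finrank {V : Type*} [AddCommGroup V] [Module K V] [FiniteDimensional K V] :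
    vdim K V = (Module.finrank K V : ℕ∞) := by
  rw [vdim, ← Module.finrank_eq_rank, Cardinal.toENat_nat]

theorem vdim_ne_top_iff {V : Type*} [AddCommGroup V] [Module K V] :
    vdim K V ≠ ⊤ ↔ FiniteDimensional K V := by
  rw [vdim, Ne, Cardinal.toENat_eq_top, not_le, Module.rank_lt_aleph0_iff]

theorem vdim_quotient_add {V : Type*} [AddCommGroup V] [Module K V] (N : Submodule K V) :
    vdim K (V ⧸ N) + vdim K N = vdim K V := by
  rw [vdim, vdim, vdim, ← map_add, Submodule.rank_quotient_add_rank]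

theorem vdim_le_of_surjective {V W : Type*} [AddCommGroup V] [Module K V] [AddCommGroup W]
    [Module K W] (f : V →ₗ[K] W) (hf : Function.Surjective f) : vdim K W ≤ vdim K V := by
  rw [← vdim_congr (f.quotKerEquivOfSurjective hf), ← vdim_quotient_add (LinearMap.ker f)]
  exact le_self_add

theorem vdim_prod_fin {V : Type*} [AddCommGroup V] [Module K V] (r : ℕ) :
    vdim K (Fin r → V) = r * vdim K V := by
  rw [vdim, rank_pi, Cardinal.sum_const]
  simp [vdim]

/-- Filter W by im g ⊇ im (g ∘ f); injectivity of g identifies im g / im (g ∘ f) with coker f. -/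
theorem vdim_coker_comp {U V W : Type*} [AddCommGroup U] [Module K U]
    [AddCommGroup V] [Module K V] [AddCommGroup W] [Module K W] (f : U →ₗ[K] V)
    (g : V →ₗ[K] W) (hg : Function.Injective g) :
    vdim K (W ⧸ LinearMap.range (g ∘ₗ f)) =
      vdim K (W ⧸ LinearMap.range g) + vdim K (V ⧸ LinearMap.range f) := by
  have hle : LinearMap.range (g ∘ₗ f) ≤ LinearMap.range g := LinearMap.range_comp_le_range f g
  rw [← vdim_quotient_add ((LinearMap.range g).map (LinearMap.range (g ∘ₗ f)).mkQ),
    vdim_congr (Submodule.quotientQuotientEquivQuotient _ _ hle)]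
  congr 1
  refine (vdim_congr ?_).symm
  let φ : V →ₗ[K] ((LinearMap.range g).map (LinearMap.range (g ∘ₗ f)).mkQ) :=
    LinearMap.codRestrict _ ((LinearMap.range (g ∘ₗ f)).mkQ ∘ₗ g)
      (fun v => Submodule.mem_map_of_mem ⟨v, rfl⟩)
  have hker : LinearMap.ker φ = LinearMap.range f := by
    ext v
    simp only [φ, LinearMap.ker_codRestrict, LinearMap.mem_ker, LinearMap.comp_apply,
      Submodule.mkQ_apply, Submodule.Quotient.mk_eq_zero, LinearMap.mem_range]
    exact ⟨fun ⟨u, hu⟩ => ⟨u, hg hu⟩, fun ⟨u, hu⟩ => ⟨u, by rw [hu]⟩⟩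
  have hsurj : Function.Surjective φ := by
    rintro ⟨w, hw⟩
    obtain ⟨_, ⟨v, rfl⟩, rfl⟩ := hw
    exact ⟨v, rfl⟩
  exact (Submodule.quotEquivOfEq _ _ hker.symm).trans (φ.quotKerEquivOfSurjective hsurj)

/-- The cokernel of φ ∘ i = i ∘ ψ is computed in two ways, and the finite dimension of coker i
cancels. -/
theorem vdim_coker_eq_of_intertwine {V W : Type*} [AddCommGroup V] [Module K V] [AddCommGroup W]
    [Module K W] (i : W →ₗ[K] V) (hi : Function.Injective i)
    [FiniteDimensional K (V ⧸ LinearMap.range i)] (φ : V →ₗ[K] V) (hφ : Function.Injective φ)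
    (ψ : W →ₗ[K] W) (h : φ ∘ₗ i = i ∘ₗ ψ) :
    vdim K (V ⧸ LinearMap.range φ) = vdim K (W ⧸ LinearMap.range ψ) := by
  have h1 := vdim_coker_comp i φ hφ
  have h2 := vdim_coker_comp ψ i hi
  rw [h, h2, add_comm] at h1
  exact (WithTop.add_right_cancel (vdim_ne_top_iff.mpr inferInstance) h1).symm

end LinearAlgebra

/-! ### Codimension of principal ideals -/

section Colength

variable {K A : Type*} [Field K] [CommRing A] [Algebra K A]

/-- The codimension of the principal ideal generated by `a`. -/
noncomputable def colength (K : Type*) {A : Type*} [Field K] [CommRing A] [Algebra K A] (a : A) :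
    ℕ∞ :=
  vdim K (A ⧸ Ideal.span {a})

theorem colength_eq_vdim_coker (a : A) :
    colength K a = vdim K (A ⧸ LinearMap.range (LinearMap.mulLeft K a)) := by
  refine vdim_congr ?_
  refine (Submodule.Quotient.restrictScalarsEquiv K (Ideal.span {a})).symm.trans
    (Submodule.quotEquivOfEq _ _ ?_)
  ext b
  simp only [Submodule.restrictScalars_mem, Ideal.mem_span_singleton', LinearMap.mem_range,
    LinearMap.mulLeft_apply]
  exact exists_congr fun c => by rw [mul_comm]

theorem colength_mul {a : A} (ha : Function.Injective (a * ·)) (b : A) :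
    colength K (a * b) = colength K a + colength K b := by
  simp only [colength_eq_vdim_coker]
  rw [← vdim_coker_comp (LinearMap.mulLeft K b) (LinearMap.mulLeft K a) ha, LinearMap.mulLeft_mul]

theorem colength_eq_zero_iff {a : A} : colength K a = 0 ↔ IsUnit a := by
  rw [colength, vdim, Cardinal.toENat_eq_zero, rank_zero_iff, Ideal.Quotient.subsingleton_iff,
    Ideal.span_singleton_eq_top]

theorem vdim_quotient_span_pair (f h : A) :
    vdim K (A ⧸ Ideal.span ({f, h} : Set A)) =
      colength K (Ideal.Quotient.mk (Ideal.span {h}) f) := by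
  refine vdim_congr ?_
  have e := (DoubleQuot.quotQuotEquivQuotSupₐ K (Ideal.span {h}) (Ideal.span {f})).symm
  have h1 : Ideal.span ({f, h} : Set A) = Ideal.span {h} ⊔ Ideal.span {f} := by
    rw [Ideal.span_insert, sup_comm]
  have h2 : (Ideal.span {f}).map (Ideal.Quotient.mkₐ K (Ideal.span {h})) =
      Ideal.span {Ideal.Quotient.mk (Ideal.span {h}) f} := by
    rw [Ideal.map_span, Set.image_singleton]; rfl
  exact ((Ideal.quotientEquivAlgOfEq K h1).trans
    (e.trans (Ideal.quotientEquivAlgOfEq K h2))).toLinearEquiv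

end Colength

/-! ### Expansion in powers of a uniformizer -/

section Expansion

open IsLocalRing PowerSeries

variable {K B : Type*} [Field K] [CommRing B] [IsDomain B] [IsDiscreteValuationRing B]
  [Algebra K B]

/-- A discrete valuation ring containing a coefficient field embeds into the power series ring over
that field, by iterated expansion in powers of a uniformizer; the embedding carries the valuation
to the order. -/
theorem exists_expansion_of_dvr
    (hres : Function.Bijective (algebraMap K (ResidueField B))) :
    ∃ F : B →ₐ[K] K⟦X⟧, ∀ b, (F b).order = IsDiscreteValuationRing.addVal B b := by
  obtain ⟨π, hπ⟩ := IsDiscreteValuationRing.exists_irreducible B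
  have hπ0 : π ≠ 0 := hπ.ne_zero
  let e : K ≃ₐ[K] ResidueField B := AlgEquiv.ofBijective (Algebra.ofId K (ResidueField B)) hres
  let c : B →ₐ[K] K := (e.symm : ResidueField B →ₐ[K] K).comp
    (IsScalarTower.toAlgHom K B (ResidueField B))
  have hc0 : ∀ b, c b = 0 ↔ π ∣ b := by
    intro b
    have : c b = 0 ↔ residue B b = 0 := by
      change e.symm (residue B b) = 0 ↔ _
      rw [map_eq_zero_iff _ e.symm.injective]
    rw [this, residue_eq_zero_iff, hπ.maximalIdeal_eq, Ideal.mem_span_singleton]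
  -- Here `c` reads off the constant term and `s` will be the shift b ↦ (b - c b) / π, so the k-th
  -- coefficient of b is c (s^k b).
  have hs : ∀ b, ∃ b', b = algebraMap K B (c b) + π * b' := by
    intro b
    have h1 : c (b - algebraMap K B (c b)) = 0 := by
      rw [map_sub, AlgHom.commutes]; simp
    obtain ⟨b', hb'⟩ := (hc0 _).mp h1
    exact ⟨b', by rw [← hb']; ring⟩
  choose s hs using hs
  have hs_unique : ∀ b (k : K) b', b = algebraMap K B k + π * b' → c b = k ∧ s b = b' := by
    intro b k b' h
    have hk : c b = k := by
      rw [h, map_add, AlgHom.commutes, map_mul, (hc0 π).mpr dvd_rfl]; simp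
    refine ⟨hk, mul_left_cancel₀ hπ0 ?_⟩
    have h2 := hs b
    rw [hk] at h2
    exact add_left_cancel (h2.symm.trans h)
  let F : B → K⟦X⟧ := fun b => PowerSeries.mk fun k => c (s^[k] b)
  have hF : ∀ b, F b = C (c b) + X * F (s b) := by
    intro b
    ext k
    cases k with
    | zero => simp [F]
    | succ k => simp [F, coeff_succ_X_mul, Function.iterate_succ_apply]
  have hs_add : ∀ a b, s (a + b) = s a + s b := fun a b =>
    (hs_unique _ (c a + c b) _ (by
      conv_lhs => rw [hs a, hs b]
      rw [map_add]; ring)).2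
  have hs_C : ∀ k, s (algebraMap K B k) = 0 := fun k => (hs_unique _ k _ (by ring)).2
  have hs_mul : ∀ a b, s (a * b) = a * s b + algebraMap K B (c b) * s a := fun a b =>
    (hs_unique _ (c a * c b) _ (by
      conv_lhs => rw [hs b]
      rw [map_mul, mul_add]
      nth_rewrite 1 [hs a]
      ring)).2
  have hF_add : ∀ a b, F (a + b) = F a + F b := by
    intro a b
    have hit : ∀ k, s^[k] (a + b) = s^[k] a + s^[k] b := by
      intro k
      induction k with
      | zero => rfl
      | succ k ih => rw [Function.iterate_succ_apply', Function.iterate_succ_apply',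
          Function.iterate_succ_apply', ih, hs_add]
    ext k
    simp [F, hit]
  have hF_zero : F 0 = 0 := by simpa using hF_add 0 0
  have hF_C : ∀ k, F (algebraMap K B k) = C k := by
    intro k
    rw [hF, hs_C, hF_zero, AlgHom.commutes]; simp
  have hF_smul : ∀ k b, F (algebraMap K B k * b) = C k * F b := by
    intro k b
    have hsm : ∀ b, s (algebraMap K B k * b) = algebraMap K B k * s b := by
      intro b; rw [hs_mul, hs_C, mul_zero, add_zero]
    have hit : ∀ j, s^[j] (algebraMap K B k * b) = algebraMap K B k * s^[j] b := by
      intro j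
      induction j with
      | zero => rfl
      | succ j ih => rw [Function.iterate_succ_apply', Function.iterate_succ_apply', ih, hsm]
    ext j
    simp [F, hit]
  -- The recursions for `F` and `s` make the defect at (a, b) equal to X times the defect at (a, s
  -- b), so it is divisible by every power of X.
  have hF_mul : ∀ a b, F (a * b) = F a * F b := by
    have key : ∀ n : ℕ, ∀ a b, X ^ n ∣ F (a * b) - F a * F b := by
      intro n
      induction n with
      | zero => intro a b; simp
      | succ n ih =>
        intro a b
        obtain ⟨q, hq⟩ := ih a (s b)
        refine ⟨q, ?_⟩
        rw [pow_succ', mul_assoc, ← hq, hF (a * b), hs_mul, hF_add, hF_smul, map_mul, map_mul, hF b]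
        linear_combination (-C (c b)) * (hF a)
    intro a b
    rw [← sub_eq_zero]
    ext k
    exact (X_pow_dvd_iff.mp (key (k + 1) a b)) k (Nat.lt_succ_self k)
  let Fhom : B →ₐ[K] K⟦X⟧ :=
    { toFun := F
      map_one' := by simpa using hF_C 1
      map_mul' := hF_mul
      map_zero' := hF_zero
      map_add' := hF_add
      commutes' := hF_C }
  have hFπ : F π = X := by
    rw [hF, (hc0 π).mpr dvd_rfl, (hs_unique π 0 1 (by simp)).2]
    have : F 1 = 1 := by simpa using hF_C 1
    simp [this]
  refine ⟨Fhom, fun b => ?_⟩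
  rcases eq_or_ne b 0 with rfl | hb
  · simp
  obtain ⟨n, u, rfl⟩ := IsDiscreteValuationRing.eq_unit_mul_pow_irreducible hb hπ
  have hu : (F (u : B)).order = 0 := by
    have := (u.isUnit.map Fhom)
    exact (PowerSeries.order_zero_of_unit this)
  rw [IsDiscreteValuationRing.addVal_def' u hπ n]
  change (F _).order = _
  have hpow : F (π ^ n) = X ^ n := by
    rw [← hFπ]; exact map_pow Fhom π n
  rw [hF_mul, order_mul, hu, hpow, zero_add, order_X_pow]

end Expansion

/-! ### Multiplication on modules of finite rank -/

section RankFormula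

variable {K A : Type*} [Field K] [CommRing A] [Algebra K A]

theorem finiteDimensional_of_isTorsionBySet {Q : Type*} [AddCommGroup Q] [Module A Q] [Module K Q]
    [IsScalarTower K A Q] [Module.Finite A Q] (I : Ideal A) [FiniteDimensional K (A ⧸ I)]
    (hQ : Module.IsTorsionBySet A Q I) : FiniteDimensional K Q := by
  let := hQ.module
  have : IsScalarTower A (A ⧸ I) Q := hQ.isScalarTower
  have : IsScalarTower K (A ⧸ I) Q := by
    refine ⟨fun k x q => ?_⟩
    obtain ⟨a, rfl⟩ := Ideal.Quotient.mk_surjective x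
    have h1 : ∀ a : A, (Ideal.Quotient.mk I a) • q = a • q := fun a => hQ.mk_smul a q
    have h2 : k • (Ideal.Quotient.mk I a) = Ideal.Quotient.mk I (k • a) := rfl
    rw [h2, h1, h1, smul_assoc]
  have : Module.Finite (A ⧸ I) Q := Module.Finite.of_restrictScalars_finite A (A ⧸ I) Q
  exact Module.Finite.trans (A ⧸ I) Q

variable [IsDomain A]

/-- A maximal independent family spans a free submodule with torsion quotient. That quotient is
killed by some b ≠ 0, hence finite-dimensional, so M may be replaced by the free submodule, where
the cokernel splits into r copies. -/
theorem vdim_coker_smul_eq_finrank_mul {M : Type*} [AddCommGroup M] [Module A M] [Module K M]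
    [IsScalarTower K A M] [Module.Finite A M] [Module.IsTorsionFree A M]
    (hA : ∀ a : A, a ≠ 0 → colength K a ≠ ⊤) {a : A} (ha : a ≠ 0) :
    vdim K (M ⧸ LinearMap.range ((Algebra.lsmul K K M a : M →ₗ[K] M))) =
      Module.finrank A M * colength K a := by
  obtain ⟨v, hv⟩ := exists_linearIndependent_of_le_finrank (le_refl (Module.finrank A M))
  generalize hr : Module.finrank A M = r at v
  let i : (Fin r → A) →ₗ[A] M := Fintype.linearCombination A v
  have hi : Function.Injective i := by
    exact hv.fintypeLinearCombination_injective
  have hrank : Module.finrank A (M ⧸ LinearMap.range i) = 0 := by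
    have h1 := Submodule.finrank_quotient_add_finrank (LinearMap.range i)
    have h2 : Module.finrank A (LinearMap.range i) = r := by
      rw [LinearMap.finrank_range_of_inj hi]; simp
    omega
  have htors : Module.IsTorsion A (M ⧸ LinearMap.range i) :=
    Module.finrank_eq_zero_iff_isTorsion.mp hrank
  obtain ⟨b, hb1, hb2⟩ := Submodule.annihilator_top_inter_nonZeroDivisors htors
  have hb0 : b ≠ 0 := nonZeroDivisors.ne_zero hb2
  have : FiniteDimensional K (A ⧸ Ideal.span {b}) := vdim_ne_top_iff.mp (hA b hb0)
  have hfin : FiniteDimensional K (M ⧸ LinearMap.range i) := by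
    refine finiteDimensional_of_isTorsionBySet (A := A) (Ideal.span {b}) ?_
    rw [Module.isTorsionBySet_span_singleton_iff]
    intro q
    exact Submodule.mem_annihilator.mp hb1 q trivial
  have hsurj : FiniteDimensional K (M ⧸ LinearMap.range (i.restrictScalars K)) :=
    Module.Finite.equiv (Submodule.Quotient.restrictScalarsEquiv K (LinearMap.range i)).symm
  have hφ : Function.Injective (Algebra.lsmul K K M a : M →ₗ[K] M) :=
    fun x y h => smul_right_injective M ha h
  rw [vdim_coker_eq_of_intertwine (i.restrictScalars K) hi _ hφ
    (Algebra.lsmul K K (Fin r → A) a : (Fin r → A) →ₗ[K] (Fin r → A))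
    (by ext x; simp [i])]
  rw [colength_eq_vdim_coker, ← vdim_prod_fin]
  have hpi : LinearMap.range (Algebra.lsmul K K (Fin r → A) a : (Fin r → A) →ₗ[K] (Fin r → A)) =
      Submodule.pi Set.univ fun _ => LinearMap.range (LinearMap.mulLeft K a) := by
    ext x
    simp only [LinearMap.mem_range, Submodule.mem_pi, Set.mem_univ, forall_true_left,
      LinearMap.mulLeft_apply]
    constructor
    · rintro ⟨y, rfl⟩ j
      exact ⟨y j, rfl⟩
    · intro h
      choose y hy using h
      exact ⟨y, funext hy⟩
  rw [vdim_congr (Submodule.quotEquivOfEq _ _ hpi)]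
  exact vdim_congr (Submodule.quotientPi fun _ : Fin r => LinearMap.range (LinearMap.mulLeft K a))

end RankFormula

/-! ### Finiteness over K[[X]] from completeness -/

section PowerSeriesAlgebra

open PowerSeries

variable {K A : Type*} [Field K] [CommRing A] [Algebra K A] [Algebra K⟦X⟧ A]
  [IsScalarTower K K⟦X⟧ A]

theorem mem_span_singleton_pow_smul_top_iff {R M : Type*} [CommRing R] [AddCommGroup M]
    [Module R M] (a : R) (k : ℕ) (x : M) :
    x ∈ (Ideal.span {a} ^ k • (⊤ : Submodule R M)) ↔ ∃ y : M, a ^ k • y = x := by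
  rw [Ideal.span_singleton_pow, Submodule.ideal_span_singleton_smul,
    Submodule.mem_smul_pointwise_iff_exists]
  simp

theorem isPrecomplete_pi_span_singleton {R : Type*} [CommRing R] (a : R) (ι : Type*)
    [IsPrecomplete (Ideal.span {a}) R] : IsPrecomplete (Ideal.span {a}) (ι → R) := by
  refine ⟨fun f hf => ?_⟩
  have hL : ∀ j, ∃ L : R, ∀ k, f k j ≡ L [SMOD (Ideal.span {a} ^ k • ⊤ : Submodule R R)] := by
    intro j
    refine IsPrecomplete.prec inferInstance fun {m k} hmk => ?_
    have := hf hmk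
    rw [SModEq.sub_mem, mem_span_singleton_pow_smul_top_iff] at this ⊢
    obtain ⟨y, hy⟩ := this
    exact ⟨y j, congrFun hy j⟩
  choose L hL using hL
  refine ⟨L, fun k => ?_⟩
  have h1 : ∀ j, ∃ y : R, a ^ k • y = f k j - L j := fun j => by
    have := hL j k
    rwa [SModEq.sub_mem, mem_span_singleton_pow_smul_top_iff] at this
  choose y hy using h1
  rw [SModEq.sub_mem, mem_span_singleton_pow_smul_top_iff]
  exact ⟨y, funext hy⟩

/-- Lifts of generators of M/XM define a map K[[X]]^n → M that is onto modulo X; completeness of the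
source and separatedness of M make it onto. -/
theorem module_finite_of_finiteDimensional_quotient {M : Type*} [AddCommGroup M] [Module K M]
    [Module K⟦X⟧ M] [IsScalarTower K K⟦X⟧ M] [IsHausdorff (Ideal.span {(X : K⟦X⟧)}) M]
    [FiniteDimensional K (M ⧸ (Ideal.span {(X : K⟦X⟧)} • (⊤ : Submodule K⟦X⟧ M)))] :
    Module.Finite K⟦X⟧ M := by
  set I := Ideal.span {(X : K⟦X⟧)} with hI
  obtain ⟨n, b, hb⟩ := Module.Finite.exists_fin (R := K) (M := M ⧸ (I • (⊤ : Submodule K⟦X⟧ M)))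
  choose v hv using fun j => Submodule.mkQ_surjective (I • (⊤ : Submodule K⟦X⟧ M)) (b j)
  have : IsPrecomplete I (Fin n → K⟦X⟧) := isPrecomplete_pi_span_singleton _ _
  have hsurj : Function.Surjective (Fintype.linearCombination K⟦X⟧ v) := by
    refine surjective_of_mkQ_comp_surjective (I := I) fun y => ?_
    have hy : y ∈ Submodule.span K (Set.range b) := by rw [hb]; trivial
    obtain ⟨c, rfl⟩ := (Submodule.mem_span_range_iff_exists_fun K).mp hy
    refine ⟨fun j => C (c j), ?_⟩
    simp only [LinearMap.comp_apply, Fintype.linearCombination_apply, map_sum, map_smul, hv]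
    refine Finset.sum_congr rfl fun j _ => ?_
    rw [← algebraMap_smul K⟦X⟧ (c j) (b j)]
    rfl
  exact Module.Finite.of_surjective _ hsurj

end PowerSeriesAlgebra

/-! ### Codimension in domains and the order of a power series -/

section Colength

variable {K A : Type*} [Field K] [CommRing A] [Algebra K A]

theorem colength_one : colength K (1 : A) = 0 := colength_eq_zero_iff.mpr isUnit_one

theorem colength_le_colength_zero (a : A) : colength K a ≤ colength K (0 : A) := by
  have hle : Ideal.span {(0 : A)} ≤ Ideal.span {a} := by simp
  exact vdim_le_of_surjective (Ideal.Quotient.factorₐ K hle).toLinearMap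
    (Ideal.Quotient.factor_surjective hle)

variable [IsDomain A]

theorem mul_left_injective_of_ne_zero {a : A} (ha : a ≠ 0) : Function.Injective (a * ·) :=
  mul_right_injective₀ ha

theorem colength_pow {a : A} (ha : a ≠ 0) (n : ℕ) : colength K (a ^ n) = n * colength K a := by
  induction n with
  | zero => simp [colength_one]
  | succ n ih =>
    rw [pow_succ, colength_mul (mul_left_injective_of_ne_zero (pow_ne_zero n ha)), ih]
    push_cast
    ring

/-- A surjects onto every A/(a^n), of dimension at least n. -/
theorem colength_zero {a : A} (ha : a ≠ 0) (ha' : ¬ IsUnit a) : colength K (0 : A) = ⊤ := by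
  rw [ENat.eq_top_iff_forall_ge]
  intro n
  refine le_trans ?_ (colength_le_colength_zero (a ^ n))
  rw [colength_pow ha]
  have : 1 ≤ colength K a := Order.one_le_iff_ne_zero.mpr (mt colength_eq_zero_iff.mp ha')
  exact le_mul_of_one_le_right zero_le this

open PowerSeries in
theorem colength_powerSeries {K : Type*} [Field K] (f : K⟦X⟧) : colength K f = f.order := by
  have hX : colength K (X : K⟦X⟧) = 1 := by
    have e : (K⟦X⟧ ⧸ Ideal.span {(X : K⟦X⟧)}) ≃ₗ[K] K := by
      refine ((Submodule.Quotient.restrictScalarsEquiv K _).symm.trans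
        (Submodule.quotEquivOfEq _ _ ?_)).trans
        ((coeff 0 : K⟦X⟧ →ₗ[K] K).quotKerEquivOfSurjective
          fun k => ⟨C k, by simp⟩)
      ext g
      simp [Ideal.mem_span_singleton, X_dvd_iff]
    rw [colength, vdim_congr e, vdim_eq_finrank]
    simp
  rcases eq_or_ne f 0 with rfl | hf
  · rw [colength_zero (a := (X : K⟦X⟧)) X_ne_zero X_prime.not_isUnit, order_zero]
  · obtain ⟨n, u, rfl⟩ := IsDiscreteValuationRing.eq_unit_mul_pow_irreducible hf X_prime.irreducible
    rw [colength_mul (mul_left_injective_of_ne_zero u.ne_zero), colength_pow X_ne_zero, hX,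
      colength_eq_zero_iff.mpr u.isUnit, order_mul, order_zero_of_unit u.isUnit, order_X_pow]
    simp

end Colength

/-! ### Domains finite over K[[X]] -/

section Branch

open PowerSeries

variable {K : Type*} [Field K]

/-- Krull's intersection theorem in a Noetherian domain supplies the X-adic separatedness. -/
theorem module_finite_of_colength_ne_top {A : Type*} [CommRing A] [Algebra K A] [Algebra K⟦X⟧ A]
    [IsScalarTower K K⟦X⟧ A] [IsDomain A] [IsNoetherianRing A]
    (hX : ¬ IsUnit (algebraMap K⟦X⟧ A X)) (hfin : colength K (algebraMap K⟦X⟧ A X) ≠ ⊤) :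
    Module.Finite K⟦X⟧ A := by
  have hmap : (Ideal.span {(X : K⟦X⟧)}).map (algebraMap K⟦X⟧ A) =
      Ideal.span {algebraMap K⟦X⟧ A X} := by
    rw [Ideal.map_span, Set.image_singleton]
  have : IsHausdorff (Ideal.span {(X : K⟦X⟧)}) A := by
    rw [← IsHausdorff.map_algebraMap_iff (S := A), hmap]
    exact IsHausdorff.of_isDomain _ (by rwa [Ne, Ideal.span_singleton_eq_top])
  have hfd : FiniteDimensional K (A ⧸ Ideal.span {algebraMap K⟦X⟧ A X}) :=
    vdim_ne_top_iff.mp hfin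
  have : FiniteDimensional K
      (A ⧸ (Ideal.span {(X : K⟦X⟧)} • (⊤ : Submodule K⟦X⟧ A))) := by
    have hE : Ideal.span {(X : K⟦X⟧)} • (⊤ : Submodule K⟦X⟧ A) =
        (Ideal.span {algebraMap K⟦X⟧ A X}).restrictScalars K⟦X⟧ := by
      rw [Ideal.smul_top_eq_map, hmap]
    let e1 : (A ⧸ (Ideal.span {(X : K⟦X⟧)} • (⊤ : Submodule K⟦X⟧ A))) ≃ₗ[K⟦X⟧]
        (A ⧸ Ideal.span {algebraMap K⟦X⟧ A X}) :=
      (Submodule.quotEquivOfEq _ _ hE).trans (Submodule.Quotient.restrictScalarsEquiv K⟦X⟧ _)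
    exact Module.Finite.equiv (e1.restrictScalars K).symm
  exact module_finite_of_finiteDimensional_quotient (K := K)

theorem colength_algebraMap_eq_finrank_mul {A C : Type*} [CommRing A] [Algebra K A] [IsDomain A]
    [CommRing C] [Algebra K C] [IsDomain C] [Algebra A C] [IsScalarTower K A C]
    [Module.Finite A C] (hinj : Function.Injective (algebraMap A C))
    (hA : ∀ a : A, a ≠ 0 → colength K a ≠ ⊤) {a : A} (ha : a ≠ 0) :
    colength K (algebraMap A C a) = Module.finrank A C * colength K a := by
  have : FaithfulSMul A C := (faithfulSMul_iff_algebraMap_injective A C).mpr hinj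
  have : Module.IsTorsionFree A C := inferInstance
  rw [← vdim_coker_smul_eq_finrank_mul (M := C) hA ha, colength_eq_vdim_coker]
  have : LinearMap.mulLeft K (algebraMap A C a) = (Algebra.lsmul K K C a : C →ₗ[K] C) := by
    ext x
    simp [Algebra.smul_def]
  rw [this]

theorem colength_algebraMap_powerSeries {A : Type*} [CommRing A] [Algebra K A] [Algebra K⟦X⟧ A]
    [IsScalarTower K K⟦X⟧ A] [IsDomain A] [Module.Finite K⟦X⟧ A]
    (hinj : Function.Injective (algebraMap K⟦X⟧ A)) {f : K⟦X⟧} (hf : f ≠ 0) :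
    colength K (algebraMap K⟦X⟧ A f) = Module.finrank K⟦X⟧ A * f.order := by
  rw [colength_algebraMap_eq_finrank_mul hinj (fun a ha => ?_) hf, colength_powerSeries]
  rw [colength_powerSeries, Ne, order_eq_top]
  exact ha

/-- By integrality a has a nonzero multiple in K[[X]], whose codimension is finite by the rank
formula. -/
theorem colength_ne_top_of_module_finite {A : Type*} [CommRing A] [Algebra K A] [Algebra K⟦X⟧ A]
    [IsScalarTower K K⟦X⟧ A] [IsDomain A] [Module.Finite K⟦X⟧ A]
    (hinj : Function.Injective (algebraMap K⟦X⟧ A)) {a : A} (ha : a ≠ 0) :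
    colength K a ≠ ⊤ := by
  have : FaithfulSMul K⟦X⟧ A := (faithfulSMul_iff_algebraMap_injective _ A).mpr hinj
  have hint : IsIntegral K⟦X⟧ a := Algebra.IsIntegral.isIntegral a
  obtain ⟨b, r, hr, hb⟩ : ∃ b : A, ∃ r : K⟦X⟧, r ≠ 0 ∧ a * b = algebraMap K⟦X⟧ A r := by
    obtain ⟨r, hr, hr'⟩ := Submodule.exists_mem_ne_zero_of_ne_bot
      (Ideal.comap_ne_bot_of_integral_mem (R := K⟦X⟧) ha (Ideal.mem_span_singleton_self a) hint)
    obtain ⟨b, hb⟩ := Ideal.mem_span_singleton.mp (Ideal.mem_comap.mp hr)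
    exact ⟨b, r, hr', hb.symm⟩
  have h1 := colength_algebraMap_powerSeries (A := A) hinj hr
  rw [← hb, colength_mul (mul_left_injective_of_ne_zero ha)] at h1
  have h2 : (Module.finrank K⟦X⟧ A : ℕ∞) * r.order ≠ ⊤ :=
    WithTop.mul_ne_top (ENat.natCast_ne_top _) (mt order_eq_top.mp hr)
  rw [← h1] at h2
  exact fun h => h2 (by rw [h]; rfl)

/-- C is finite over K[[X]], hence over A; r is its rank over A. -/
theorem exists_colength_eq_mul {A C : Type*} [CommRing A] [Algebra K A] [Algebra K⟦X⟧ A]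
    [IsScalarTower K K⟦X⟧ A] [IsDomain A] [Module.Finite K⟦X⟧ A]
    (hinj : Function.Injective (algebraMap K⟦X⟧ A))
    [CommRing C] [Algebra K C] [IsDomain C] [IsNoetherianRing C]
    (γ : A →ₐ[K] C) (hγ : Function.Injective γ)
    (hX : ¬ IsUnit (γ (algebraMap K⟦X⟧ A X)))
    (hfin : colength K (γ (algebraMap K⟦X⟧ A X)) ≠ ⊤) :
    ∃ r : ℕ, ∀ a : A, a ≠ 0 → colength K (γ a) = r * colength K a := by
  let : Algebra A C := γ.toRingHom.toAlgebra
  let : Algebra K⟦X⟧ C := (γ.toRingHom.comp (algebraMap K⟦X⟧ A)).toAlgebra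
  have : IsScalarTower K⟦X⟧ A C := IsScalarTower.of_algebraMap_eq' rfl
  have : IsScalarTower K A C := IsScalarTower.of_algebraMap_eq fun k => (γ.commutes k).symm
  have : IsScalarTower K K⟦X⟧ C := IsScalarTower.of_algebraMap_eq fun k => by
    rw [IsScalarTower.algebraMap_apply K A C, IsScalarTower.algebraMap_apply K K⟦X⟧ A]
    rfl
  have : Module.Finite K⟦X⟧ C := module_finite_of_colength_ne_top hX hfin
  have : Module.Finite A C := Module.Finite.of_restrictScalars_finite K⟦X⟧ A C
  exact ⟨Module.finrank A C, fun a ha => colength_algebraMap_eq_finrank_mul (A := A) (C := C) hγ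
    (fun a ha => colength_ne_top_of_module_finite hinj ha) ha⟩

/-- The inseparable degree is a power of p dividing the degree. -/
theorem isSeparable_of_not_dvd_finrank {F L : Type*} [Field F] [Field L] [Algebra F L]
    [FiniteDimensional F L] (p : ℕ) [CharP F p] (hp : ¬ p ∣ Module.finrank F L) :
    Algebra.IsSeparable F L := by
  rcases CharP.char_is_prime_or_zero F p with hprime | rfl
  · have : ExpChar F p := ExpChar.prime hprime
    rw [isSeparable_iff_finInsepDegree_eq_one]
    obtain ⟨n, hn⟩ := finInsepDegree_eq_pow F L p
    have h2 := Field.finSepDegree_mul_finInsepDegree F L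
    cases n with
    | zero => simpa using hn
    | succ n =>
      refine absurd ?_ hp
      rw [← h2, hn, pow_succ]
      exact Dvd.intro_left _ (mul_assoc _ _ _)
  · have : CharZero F := CharP.charP_to_charZero F
    infer_instance

end Branch

/-! ### Parametrization of a branch by a point of its normalization -/

section Branch

open PowerSeries IsLocalRing

variable {K : Type*} [Field K] [IsAlgClosed K]

instance isMaximal_span_X : (Ideal.span {(X : K⟦X⟧)}).IsMaximal := by
  rw [← PowerSeries.maximalIdeal_eq_span_X]
  infer_instance

/-- B/q is a finite module killed by X, so it is a finite extension of the algebraically closed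
field K. -/
theorem algebraMap_residueField_localization_bijective {B : Type*} [CommRing B] [Algebra K B]
    [Algebra K⟦X⟧ B] [IsScalarTower K K⟦X⟧ B] [Module.Finite K⟦X⟧ B] (q : Ideal B) [q.IsMaximal]
    (hXq : algebraMap K⟦X⟧ B X ∈ q) :
    Function.Bijective (algebraMap K (ResidueField (Localization.AtPrime q))) := by
  have hfd : FiniteDimensional K (K⟦X⟧ ⧸ Ideal.span {(X : K⟦X⟧)}) := by
    have h : colength K (X : K⟦X⟧) ≠ ⊤ := by
      rw [colength_powerSeries, order_X]; exact ENat.one_ne_top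
    exact vdim_ne_top_iff.mp h
  have : FiniteDimensional K (B ⧸ q) := by
    refine finiteDimensional_of_isTorsionBySet (A := K⟦X⟧) (Ideal.span {(X : K⟦X⟧)}) ?_
    rw [Module.isTorsionBySet_span_singleton_iff]
    intro y
    obtain ⟨b, rfl⟩ := Ideal.Quotient.mk_surjective y
    change Ideal.Quotient.mk q (X • b) = 0
    rw [Ideal.Quotient.eq_zero_iff_mem, Algebra.smul_def]
    exact Ideal.mul_mem_right _ _ hXq
  let : Field (B ⧸ q) := Ideal.Quotient.field q
  have h1 : Function.Bijective (algebraMap K (B ⧸ q)) :=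
    IsAlgClosed.algebraMap_bijective_of_isIntegral
  have h2 := q.bijective_algebraMap_quotient_residueField.comp h1
  convert h2 using 1
  ext k
  change _ = algebraMap (B ⧸ q) q.ResidueField (algebraMap K (B ⧸ q) k)
  rw [← IsScalarTower.algebraMap_apply]

/-- The sum of e_q f_q over the primes above X is the rank, so p cannot divide every e_q. Localizing
at a good q and expanding there sends X to a series of order e_q. -/
theorem exists_algHom_order_not_dvd {B : Type*} [CommRing B] [IsDedekindDomain B]
    [Algebra K B] [Algebra K⟦X⟧ B] [IsScalarTower K K⟦X⟧ B] [Module.Finite K⟦X⟧ B]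
    (hinj : Function.Injective (algebraMap K⟦X⟧ B)) (p : ℕ)
    (hp : ¬ p ∣ Module.finrank K⟦X⟧ B) :
    ∃ (γ : B →ₐ[K] K⟦X⟧) (e : ℕ), Function.Injective γ ∧ ¬ p ∣ e ∧
      (γ (algebraMap K⟦X⟧ B X)).order = e := by
  have : FaithfulSMul K⟦X⟧ B := (faithfulSMul_iff_algebraMap_injective _ B).mpr hinj
  have : Module.IsTorsionFree K⟦X⟧ B := inferInstance
  set P : Ideal K⟦X⟧ := Ideal.span {(X : K⟦X⟧)} with hP
  let : Fintype (P.primesOver B) := (Algebra.QuasiFinite.finite_primesOver P).fintype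
  have hsum := Ideal.sum_ramification_inertia_eq_finrank P B
  obtain ⟨q, hq⟩ : ∃ q : P.primesOver B, ¬ p ∣ q.1.ramificationIdx K⟦X⟧ := by
    by_contra! hcon
    exact hp (hsum ▸ Finset.dvd_sum fun q _ => Dvd.dvd.mul_right (hcon q) _)
  obtain ⟨q, hqP⟩ := q
  simp only at hq
  have hqprime : q.IsPrime := hqP.1
  have hqover : q.LiesOver P := hqP.2
  have hqmax : q.IsMaximal := Ideal.IsMaximal.of_liesOver_isMaximal q P
  have hXq : algebraMap K⟦X⟧ B X ∈ q := by
    have : (X : K⟦X⟧) ∈ q.under K⟦X⟧ := by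
      rw [← hqover.over]; exact Ideal.mem_span_singleton_self _
    exact this
  have hX0 : algebraMap K⟦X⟧ B X ≠ 0 := by
    rw [Ne, map_eq_zero_iff _ hinj]; exact X_ne_zero
  have hq0 : q ≠ ⊥ := fun h => hX0 (by exact (Submodule.mem_bot _).mp (h ▸ hXq))
  let Bq := Localization.AtPrime q
  have hdvr : IsDiscreteValuationRing Bq :=
    IsLocalization.AtPrime.isDiscreteValuationRing_of_dedekind_domain B hq0 Bq
  have hBinj : Function.Injective (algebraMap B Bq) :=
    IsLocalization.injective Bq q.primeCompl_le_nonZeroDivisors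
  obtain ⟨F, hF⟩ := exists_expansion_of_dvr (K := K) (B := Bq)
    (algebraMap_residueField_localization_bijective q hXq)
  have hFinj : Function.Injective F := by
    rw [injective_iff_map_eq_zero]
    intro b hb
    have := hF b
    rw [hb, order_zero] at this
    exact IsDiscreteValuationRing.addVal_eq_top_iff.mp this.symm
  refine ⟨F.comp (IsScalarTower.toAlgHom K B Bq), q.ramificationIdx K⟦X⟧,
    hFinj.comp hBinj, hq, ?_⟩
  have hx0 : algebraMap B Bq (algebraMap K⟦X⟧ B X) ≠ 0 := by
    rw [Ne, map_eq_zero_iff _ hBinj]; exact hX0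
  change (F (algebraMap B Bq (algebraMap K⟦X⟧ B X))).order = _
  rw [hF]
  obtain ⟨π, hπ⟩ := IsDiscreteValuationRing.exists_irreducible Bq
  obtain ⟨m, u, hm⟩ := IsDiscreteValuationRing.eq_unit_mul_pow_irreducible hx0 hπ
  rw [IsDiscreteValuationRing.addVal_def _ u hπ m hm, Ideal.ramificationIdx_eq P q]
  -- The ramification index is the length of the localization modulo X, which is the valuation m of
  -- X.
  have hideal : P.map (algebraMap K⟦X⟧ Bq) = maximalIdeal Bq ^ m := by
    rw [hP, Ideal.map_span, Set.image_singleton, IsScalarTower.algebraMap_apply K⟦X⟧ B Bq, hm,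
      hπ.maximalIdeal_eq, Ideal.span_singleton_pow, mul_comm,
      Ideal.span_singleton_mul_right_unit u.isUnit]
  rw [hideal, IsDiscreteValuationRing.length_quotient_pow_maximalIdeal]
  simp

theorem exists_branch {A : Type*} [CommRing A] [Algebra K A] [Algebra K⟦X⟧ A]
    [IsScalarTower K K⟦X⟧ A] [IsDomain A] [IsNoetherianRing A] (p : ℕ) [CharP K p]
    (hinj : Function.Injective (algebraMap K⟦X⟧ A)) (hX : ¬ IsUnit (algebraMap K⟦X⟧ A X))
    {n : ℕ} (hn : colength K (algebraMap K⟦X⟧ A X) = n) (hpn : ¬ p ∣ n) :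
    ∃ (γ : A →ₐ[K] K⟦X⟧) (r : ℕ), Function.Injective γ ∧ ¬ p ∣ r ∧
      ∀ a, (γ a).order = r * colength K a := by
  have hfinA : Module.Finite K⟦X⟧ A :=
    module_finite_of_colength_ne_top hX (by rw [hn]; exact ENat.natCast_ne_top n)
  have hrank : Module.finrank K⟦X⟧ A = n := by
    have := colength_algebraMap_powerSeries (A := A) hinj (X_ne_zero (R := K))
    rw [hn, order_X, mul_one] at this
    exact_mod_cast this.symm
  have : FaithfulSMul K⟦X⟧ A := (faithfulSMul_iff_algebraMap_injective _ A).mpr hinj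
  let F := FractionRing K⟦X⟧
  let L := FractionRing A
  have : FaithfulSMul K⟦X⟧ L := (faithfulSMul_iff_algebraMap_injective _ L).mpr (by
    rw [IsScalarTower.algebraMap_eq K⟦X⟧ A L]
    exact (IsFractionRing.injective A L).comp hinj)
  let : Algebra F L := FractionRing.liftAlgebra K⟦X⟧ L
  have : IsScalarTower K⟦X⟧ F L := FractionRing.isScalarTower_liftAlgebra K⟦X⟧ L
  have hFL : Module.finrank F L = n := by
    rw [IsFractionRing.finrank_eq K⟦X⟧ F A L, hrank]
  have hn0 : n ≠ 0 := by rintro rfl; exact hpn (dvd_zero p)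
  have : FiniteDimensional F L := FiniteDimensional.of_finrank_pos (by omega)
  have : CharP F p := by
    have : Function.Injective ((algebraMap K⟦X⟧ F).comp (C : K →+* K⟦X⟧)) :=
      (IsFractionRing.injective K⟦X⟧ F).comp C_injective
    exact charP_of_injective_ringHom this p
  have : Algebra.IsSeparable F L := isSeparable_of_not_dvd_finrank p (hFL ▸ hpn)
  let B := integralClosure K⟦X⟧ L
  have : IsDedekindDomain B := integralClosure.isDedekindDomain K⟦X⟧ F L
  have : Module.Finite K⟦X⟧ B := IsIntegralClosure.finite K⟦X⟧ F L B
  have : IsFractionRing B L := integralClosure.isFractionRing_of_finite_extension F L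
  have hBinj : Function.Injective (algebraMap K⟦X⟧ B) := by
    refine Function.Injective.of_comp (f := algebraMap B L) ?_
    rw [← RingHom.coe_comp, ← IsScalarTower.algebraMap_eq]
    exact FaithfulSMul.algebraMap_injective K⟦X⟧ L
  have hBrank : Module.finrank K⟦X⟧ B = n := by
    rw [← IsFractionRing.finrank_eq K⟦X⟧ F B L, hFL]
  obtain ⟨δ, e, hδ, hpe, he⟩ := exists_algHom_order_not_dvd (K := K) hBinj p (hBrank ▸ hpn)
  let ι : A →ₐ[K⟦X⟧] B := (IsScalarTower.toAlgHom K⟦X⟧ A L).codRestrict B fun a =>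
    (Algebra.IsIntegral.isIntegral a).map (IsScalarTower.toAlgHom K⟦X⟧ A L)
  have hι : Function.Injective ι := fun a b h =>
    IsFractionRing.injective A L (congrArg Subtype.val h)
  let γ : A →ₐ[K] K⟦X⟧ := δ.comp (ι.restrictScalars K)
  have hγ : Function.Injective γ := hδ.comp hι
  have hγX : (γ (algebraMap K⟦X⟧ A X)).order = e := by
    rw [← he]
    change (δ (ι (algebraMap K⟦X⟧ A X))).order = _
    rw [ι.commutes]
  have he0 : e ≠ 0 := by rintro rfl; exact hpe (dvd_zero p)
  obtain ⟨r, hr⟩ := exists_colength_eq_mul hinj γ hγ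
    (fun h => he0 (by
      have := order_zero_of_unit h
      rw [hγX] at this; exact_mod_cast this))
    (by rw [colength_powerSeries, hγX]; exact ENat.natCast_ne_top e)
  have hX0 : algebraMap K⟦X⟧ A X ≠ 0 := by
    rw [Ne, map_eq_zero_iff _ hinj]; exact X_ne_zero
  -- The proportionality evaluated at X, which has codimension n in A and is sent to order e.
  have hern : e = r * n := by
    have := hr _ hX0
    rw [colength_powerSeries, hγX, hn] at this
    exact_mod_cast this
  have hpr : ¬ p ∣ r := fun h => hpe (hern ▸ Dvd.dvd.mul_right h n)
  refine ⟨γ, r, hγ, hpr, fun a => ?_⟩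
  rcases eq_or_ne a 0 with rfl | ha
  -- Both sides are ⊤ here, but r * ⊤ = ⊤ requires r ≠ 0.
  · have hr0 : (r : ℕ∞) ≠ 0 := by
      rintro h
      exact hpr (by simp [Nat.cast_eq_zero.mp h])
    rw [colength_zero hX0 hX, map_zero, order_zero, ENat.mul_top hr0]
  · rw [← hr a ha, colength_powerSeries]

end Branch

/-! ### The ring K[[x,y]] and the chain rule -/

section Ring2

open MvPowerSeries

variable {K : Type*} [Field K]

instance isDomain_ring2 : IsDomain (Ring2 K) := NoZeroDivisors.to_isDomain _

/-- K[[x,y]] is a one-variable power series ring over a principal ideal domain. -/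
instance uniqueFactorizationMonoid_ring2 : UniqueFactorizationMonoid (Ring2 K) := by
  have : IsDomain (MvPowerSeries (Fin 1) K) := NoZeroDivisors.to_isDomain _
  have e : MvPowerSeries (Fin 1) K ≃ₐ[K] PowerSeries K :=
    renameEquiv K (Equiv.ofUnique (Fin 1) Unit)
  have : IsPrincipalIdealRing (MvPowerSeries (Fin 1) K) :=
    IsPrincipalIdealRing.of_surjective e.symm.toRingEquiv.toRingHom e.symm.surjective
  exact MulEquiv.uniqueFactorizationMonoid (finSuccEquiv K 1).symm.toMulEquiv inferInstance

theorem not_isUnit_iff {f : Ring2 K} : ¬ IsUnit f ↔ constantCoeff f = 0 := by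
  rw [isUnit_iff_constantCoeff, isUnit_iff_ne_zero, not_not]

theorem not_isUnit_iff_one_le_order {f : Ring2 K} : ¬ IsUnit f ↔ 1 ≤ f.order := by
  rw [not_isUnit_iff, one_le_order_iff_constCoeff_eq_zero]

theorem irreducible_of_order_eq_one {f : Ring2 K} (hf : f.order = 1) : Irreducible f := by
  refine ⟨not_isUnit_iff_one_le_order.mpr hf.ge, fun a b hab => ?_⟩
  by_contra! h
  rw [not_isUnit_iff_one_le_order, not_isUnit_iff_one_le_order] at h
  rw [hab, order_mul] at hf
  have h2 := add_le_add h.1 h.2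
  rw [hf] at h2
  exact absurd h2 (by decide)

theorem order_X_eq_one (i : Fin 2) : (X i : Ring2 K).order = 1 := by
  rw [X, order_monomial_of_ne_zero one_ne_zero]
  simp

theorem not_X_dvd_X {i j : Fin 2} (hij : i ≠ j) : ¬ (X i : Ring2 K) ∣ X j := by
  classical
  rw [X_dvd_iff]
  push Not
  refine ⟨Finsupp.single j 1, by simp [hij.symm], by simp⟩

theorem exists_not_dvd_X {h : Ring2 K} (hh : ¬ IsUnit h) : ∃ i : Fin 2, ¬ h ∣ X i := by
  by_contra! hc
  have hirr : ∀ i, Irreducible (X i : Ring2 K) := fun i =>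
    irreducible_of_order_eq_one (order_X_eq_one i)
  have h0 := (hirr 0).dvd_iff.mp (hc 0) |>.resolve_left hh
  have h1 := (hirr 1).dvd_iff.mp (hc 1) |>.resolve_left hh
  exact not_X_dvd_X (K := K) (i := 0) (j := 1) (by decide) (h0.trans h1.symm).dvd

theorem exists_eq_C_add_X_mul_add_X_mul (f : Ring2 K) :
    ∃ a b : Ring2 K, f = C (constantCoeff f) + X 0 * a + X 1 * b := by
  classical
  -- The part of f free of x: then x divides f - g, and y divides g minus its constant term.
  let g : Ring2 K := fun n => if n 0 = 0 then coeff n f else 0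
  have hg : ∀ n, coeff n g = if n 0 = 0 then coeff n f else 0 := fun n => rfl
  have h0 : (X 0 : Ring2 K) ∣ f - g := by
    rw [X_dvd_iff]
    intro m hm
    rw [map_sub, hg, if_pos hm, sub_self]
  have h1 : (X 1 : Ring2 K) ∣ g - C (constantCoeff f) := by
    rw [X_dvd_iff]
    intro m hm
    rw [map_sub, hg, coeff_C]
    by_cases h : m = 0
    · subst h; simp
    · have : m 0 ≠ 0 := fun h' => h (by ext i; fin_cases i <;> simpa)
      simp [h, this]
  obtain ⟨a, ha⟩ := h0
  obtain ⟨b, hb⟩ := h1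
  exact ⟨a, b, by rw [← ha, add_assoc, ← hb]; ring⟩

/-- Any algebra map is automatically local: for c ≠ 0 the unit x_i - c would go to a series without
constant term. -/
theorem constantCoeff_map_X (γ : Ring2 K →ₐ[K] PowerSeries K) (i : Fin 2) :
    PowerSeries.constantCoeff (γ (X i)) = 0 := by
  by_contra hc
  set c := PowerSeries.constantCoeff (γ (X i)) with hcdef
  have hu : IsUnit (X i - algebraMap K (Ring2 K) c) := by
    rw [← not_not (a := IsUnit _), not_isUnit_iff, map_sub, MvPowerSeries.algebraMap_apply]
    simpa using hc
  have h2 := (hu.map γ).map (PowerSeries.constantCoeff (R := K))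
  rw [map_sub, AlgHom.commutes, map_sub, ← hcdef] at h2
  simp at h2

open PowerSeries in
/-- The chain rule for a parametrization `γ` of a plane branch. -/
theorem derivative_algHom (γ : Ring2 K →ₐ[K] K⟦X⟧) (f : Ring2 K) :
    d⁄dX K (γ f) = γ (dx f) * d⁄dX K (γ (MvPowerSeries.X 0)) +
      γ (dy f) * d⁄dX K (γ (MvPowerSeries.X 1)) := by
  -- The defect of the chain rule: a derivation along γ that kills constants, x and y.
  let D : Ring2 K → K⟦X⟧ := fun f => d⁄dX K (γ f) - γ (dx f) * d⁄dX K (γ (MvPowerSeries.X 0)) -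
      γ (dy f) * d⁄dX K (γ (MvPowerSeries.X 1))
  have hadd : ∀ f g, D (f + g) = D f + D g := fun f g => by
    simp only [D, dx, dy, map_add]; ring
  have hmul : ∀ f g, D (f * g) = γ f * D g + γ g * D f := fun f g => by
    simp only [D, dx, dy, map_mul, Derivation.leibniz, map_add, smul_eq_mul]; ring
  have hC : ∀ c : K, D (MvPowerSeries.C c) = 0 := fun c => by
    have : γ (MvPowerSeries.C c) = PowerSeries.C c := γ.commutes c
    simp [D, dx, dy, this]
  have hX0 : D (MvPowerSeries.X 0) = 0 := by
    have : pderiv K (1 : Fin 2) (MvPowerSeries.X 0) = 0 := pderiv_X_of_ne (by decide)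
    simp [D, dx, dy, this]
  have hX1 : D (MvPowerSeries.X 1) = 0 := by
    have : pderiv K (0 : Fin 2) (MvPowerSeries.X 1) = 0 := pderiv_X_of_ne (by decide)
    simp [D, dx, dy, this]
  -- Writing f = c + x a + y b gives D f = γ(x) D a + γ(y) D b, which gains a factor X at each
  -- round; no continuity of γ is needed.
  have key : ∀ k : ℕ, ∀ f, (X : K⟦X⟧) ^ k ∣ D f := by
    intro k
    induction k with
    | zero => simp
    | succ k ih =>
      intro f
      obtain ⟨a, b, hab⟩ := exists_eq_C_add_X_mul_add_X_mul f
      rw [hab, hadd, hadd, hC, hmul, hmul, hX0, hX1, zero_add, mul_zero, mul_zero, add_zero,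
        add_zero, pow_succ']
      exact dvd_add (mul_dvd_mul (X_dvd_iff.mpr (constantCoeff_map_X γ 0)) (ih a))
        (mul_dvd_mul (X_dvd_iff.mpr (constantCoeff_map_X γ 1)) (ih b))
  have h0 : D f = 0 := by
    ext k
    exact X_pow_dvd_iff.mp (key (k + 1) f) k (Nat.lt_succ_self k)
  linear_combination h0

end Ring2

/-! ### Order of a derivative in characteristic p -/

section Derivative

open PowerSeries

variable {K : Type*} [Field K]

theorem order_le_order_derivative_add_one (g : K⟦X⟧) : g.order ≤ (d⁄dX K g).order + 1 := by
  by_contra! h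
  cases hm : (d⁄dX K g).order with
  | top => simp [hm] at h
  | coe m =>
    rw [hm] at h
    refine (order_eq_nat.mp hm).1 ?_
    rw [coeff_derivative, coeff_of_lt_order (m + 1) (by exact_mod_cast h), zero_mul]

/-- The leading coefficient gets multiplied by n, which vanishes in K exactly when p divides n. -/
theorem order_derivative_add_one_eq_iff (p : ℕ) [CharP K p] {g : K⟦X⟧} {n : ℕ} (hn : g.order = n)
    (hn0 : n ≠ 0) : (d⁄dX K g).order + 1 = n ↔ ¬ p ∣ n := by
  obtain ⟨m, rfl⟩ := Nat.exists_eq_succ_of_ne_zero hn0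
  obtain ⟨h1, h2⟩ := order_eq_nat.mp hn
  have h3 : (d⁄dX K g).order + 1 = (m.succ : ℕ) ↔ (d⁄dX K g).order = m := by
    rw [Nat.cast_succ]
    exact WithTop.add_right_inj ENat.one_ne_top
  rw [h3, order_eq_nat, ← CharP.cast_eq_zero_iff K p]
  have h4 : ∀ i < m, coeff i (d⁄dX K g) = 0 := fun i hi => by
    rw [coeff_derivative, h2 (i + 1) (by omega), zero_mul]
  rw [and_iff_left h4, coeff_derivative, Nat.cast_succ, mul_ne_zero_iff]
  exact ⟨fun h => h.2, fun h => ⟨h1, h⟩⟩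

end Derivative

/-! ### Cancellation in ℕ∞ -/

section ENat

theorem enat_mul_le_mul_iff {r : ℕ} (hr : r ≠ 0) {a b : ℕ∞} :
    (r : ℕ∞) * a ≤ r * b ↔ a ≤ b :=
  ENat.mul_le_mul_left_iff (Nat.cast_ne_zero.mpr hr) (ENat.natCast_ne_top r)

theorem enat_mul_eq_mul_iff {r : ℕ} (hr : r ≠ 0) {a b : ℕ∞} :
    (r : ℕ∞) * a = r * b ↔ a = b := by
  simp only [le_antisymm_iff, enat_mul_le_mul_iff hr]

theorem multiset_sum_eq_sum_iff {ι : Type*} (s : Multiset ι) (a b : ι → ℕ∞)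
    (hab : ∀ i ∈ s, a i ≤ b i) (ha : ∀ i ∈ s, a i ≠ ⊤) :
    (s.map a).sum = (s.map b).sum ↔ ∀ i ∈ s, a i = b i := by
  have key : ∀ s : Multiset ι, (∀ i ∈ s, a i ≤ b i) → (∀ i ∈ s, a i ≠ ⊤) →
      (s.map a).sum ≠ ⊤ ∧ ((s.map a).sum = (s.map b).sum → ∀ i ∈ s, a i = b i) := by
    intro s
    induction s using Multiset.induction_on with
    | empty => intro _ _; simp
    | cons i s ih =>
      intro h1 h2
      simp only [Multiset.mem_cons, forall_eq_or_imp] at h1 h2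
      obtain ⟨h3, h4⟩ := ih h1.2 h2.2
      simp only [Multiset.map_cons, Multiset.sum_cons, Multiset.mem_cons, forall_eq_or_imp]
      refine ⟨WithTop.add_ne_top.mpr ⟨h2.1, h3⟩, fun h => ?_⟩
      have hle : (s.map a).sum ≤ (s.map b).sum := Multiset.sum_map_le_sum_map _ _ h1.2
      have hi : a i = b i := by
        by_contra hne
        exact (ENat.add_lt_add_of_lt_of_le h3 (lt_of_le_of_ne h1.1 hne) hle).ne h
      rw [← hi] at h
      exact ⟨hi, h4 (WithTop.add_left_cancel h2.1 h)⟩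
  refine ⟨(key s hab ha).2, fun h => ?_⟩
  rw [Multiset.map_congr rfl h]

end ENat

/-! ### Intersection numbers and parametrizations -/

section IntersectionNumber

open MvPowerSeries

variable {K : Type*} [Field K]

theorem intersectionNumber_eq_vdim (f g : Ring2 K) :
    intersectionNumber f g = vdim K (Ring2 K ⧸ Ideal.span ({f, g} : Set (Ring2 K))) := rfl

theorem intersectionNumber_eq_colength (f h : Ring2 K) :
    intersectionNumber f h = colength K (Ideal.Quotient.mk (Ideal.span {h}) f) :=
  vdim_quotient_span_pair f h

theorem intersectionNumber_comm (f g : Ring2 K) :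
    intersectionNumber f g = intersectionNumber g f := by
  rw [intersectionNumber, Set.pair_comm]; rfl

theorem intersectionNumber_le_of_dvd (f : Ring2 K) {g h : Ring2 K} (hgh : g ∣ h) :
    intersectionNumber f g ≤ intersectionNumber f h := by
  have hle : Ideal.span ({f, h} : Set (Ring2 K)) ≤ Ideal.span ({f, g} : Set (Ring2 K)) := by
    rw [Ideal.span_insert, Ideal.span_insert]
    exact sup_le_sup_left (Ideal.span_singleton_le_span_singleton.mpr hgh) _
  exact vdim_le_of_surjective (Ideal.Quotient.factorₐ K hle).toLinearMap
    (Ideal.Quotient.factor_surjective hle)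

theorem intersectionNumber_eq_of_associated (f : Ring2 K) {g h : Ring2 K} (hgh : Associated g h) :
    intersectionNumber f g = intersectionNumber f h :=
  le_antisymm (intersectionNumber_le_of_dvd f hgh.dvd) (intersectionNumber_le_of_dvd f hgh.symm.dvd)

theorem intersectionNumber_one (f : Ring2 K) : intersectionNumber f 1 = 0 := by
  rw [intersectionNumber_comm, intersectionNumber_eq_colength, map_one, colength_one]

theorem isUnit_mk_iff {h f : Ring2 K} (hh : ¬ IsUnit h) :
    IsUnit (Ideal.Quotient.mk (Ideal.span {h}) f) ↔ IsUnit f := by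
  refine ⟨fun hu => ?_, fun hu => hu.map _⟩
  obtain ⟨b, hb⟩ := hu.exists_right_inv
  obtain ⟨g, rfl⟩ := Ideal.Quotient.mk_surjective b
  rw [← map_mul, ← map_one (Ideal.Quotient.mk (Ideal.span {h})),
    Ideal.Quotient.mk_eq_mk_iff_sub_mem, Ideal.mem_span_singleton] at hb
  obtain ⟨c, hc⟩ := hb
  rw [not_isUnit_iff] at hh
  have := congrArg constantCoeff hc
  rw [map_sub, map_mul, map_mul, hh, zero_mul, map_one, sub_eq_zero] at this
  rw [isUnit_iff_constantCoeff]
  exact IsUnit.of_mul_eq_one _ this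

theorem intersectionNumber_eq_zero_iff {f h : Ring2 K} (hh : ¬ IsUnit h) :
    intersectionNumber f h = 0 ↔ IsUnit f := by
  rw [intersectionNumber_eq_colength, colength_eq_zero_iff, isUnit_mk_iff hh]

theorem isDomain_quotient {h : Ring2 K} (hh : Prime h) : IsDomain (Ring2 K ⧸ Ideal.span {h}) := by
  have : (Ideal.span {h}).IsPrime := (Ideal.span_singleton_prime hh.ne_zero).mpr hh
  infer_instance

theorem exists_ne_zero_not_isUnit_quotient {h : Ring2 K} (hh : ¬ IsUnit h) :
    ∃ a : Ring2 K ⧸ Ideal.span {h}, a ≠ 0 ∧ ¬ IsUnit a := by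
  obtain ⟨i, hi⟩ := exists_not_dvd_X hh
  refine ⟨Ideal.Quotient.mk _ (X i), ?_, ?_⟩
  · rwa [Ne, Ideal.Quotient.eq_zero_iff_mem, Ideal.mem_span_singleton]
  · rw [isUnit_mk_iff hh, not_isUnit_iff, constantCoeff_X]

theorem intersectionNumber_eq_top_of_dvd {f h : Ring2 K} (hh : Prime h) (hf : h ∣ f) :
    intersectionNumber f h = ⊤ := by
  have := isDomain_quotient hh
  obtain ⟨a, ha, ha'⟩ := exists_ne_zero_not_isUnit_quotient hh.not_isUnit
  rw [intersectionNumber_eq_colength,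
    Ideal.Quotient.eq_zero_iff_mem.mpr (Ideal.mem_span_singleton.mpr hf), colength_zero ha ha']

/-- If h divides f, both sides are infinite. Otherwise, h being prime, multiplication by h is
injective modulo f, and codimensions add. -/
theorem intersectionNumber_mul {f h : Ring2 K} (hh : Prime h) (g : Ring2 K) :
    intersectionNumber f (h * g) = intersectionNumber f h + intersectionNumber f g := by
  by_cases hf : h ∣ f
  · rw [intersectionNumber_eq_top_of_dvd hh hf, top_add, ← top_le_iff,
      ← intersectionNumber_eq_top_of_dvd hh hf]
    exact intersectionNumber_le_of_dvd f (dvd_mul_right h g)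
  · rw [intersectionNumber_comm, intersectionNumber_comm f h, intersectionNumber_comm f g]
    simp only [intersectionNumber_eq_colength, map_mul]
    refine colength_mul ?_ _
    intro a b hab
    obtain ⟨a, rfl⟩ := Ideal.Quotient.mk_surjective a
    obtain ⟨b, rfl⟩ := Ideal.Quotient.mk_surjective b
    simp only [← map_mul] at hab
    rw [Ideal.Quotient.mk_eq_mk_iff_sub_mem, Ideal.mem_span_singleton, ← mul_sub] at hab
    rw [Ideal.Quotient.mk_eq_mk_iff_sub_mem, Ideal.mem_span_singleton]
    obtain ⟨c, hc⟩ := hab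
    obtain ⟨d, rfl⟩ := (hh.dvd_or_dvd (Dvd.intro _ hc)).resolve_left hf
    exact ⟨d, mul_left_cancel₀ hh.ne_zero (by rw [hc]; ring)⟩

theorem intersectionNumber_multiset_prod (f : Ring2 K) (s : Multiset (Ring2 K))
    (hs : ∀ h ∈ s, Prime h) :
    intersectionNumber f s.prod = (s.map fun h => intersectionNumber f h).sum := by
  induction s using Multiset.induction_on with
  | empty => simpa using intersectionNumber_one f
  | cons h s ih =>
    simp only [Multiset.mem_cons, forall_eq_or_imp] at hs
    rw [Multiset.prod_cons, intersectionNumber_mul hs.1, ih hs.2, Multiset.map_cons,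
      Multiset.sum_cons]

theorem notCongrZero_iff {p : ℕ} {n : ℕ∞} : NotCongrZero p n ↔ ∃ m : ℕ, n = m ∧ ¬ p ∣ m := by
  simp only [NotCongrZero, Nat.modEq_zero_iff_dvd]

/-- If the intersection number of the plane branch `h` with some curve is prime to the
characteristic, then `h` admits a parametrization that computes all the intersection numbers with
`h` up to a factor prime to the characteristic. -/
theorem exists_parametrization [IsAlgClosed K] (p : ℕ) [CharP K p] {h l : Ring2 K} (hh : Prime h)
    {n : ℕ} (hn : intersectionNumber l h = n) (hpn : ¬ p ∣ n) :
    ∃ (γ : Ring2 K →ₐ[K] PowerSeries K) (r : ℕ), ¬ p ∣ r ∧ (∀ g, γ g = 0 ↔ h ∣ g) ∧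
      ∀ g, (γ g).order = r * intersectionNumber g h := by
  have hn0 : n ≠ 0 := by rintro rfl; exact hpn (dvd_zero p)
  have hlu : ¬ IsUnit l := by
    rw [← intersectionNumber_eq_zero_iff hh.not_isUnit, hn]
    exact_mod_cast hn0
  have hlh : ¬ h ∣ l := fun hd => by
    rw [intersectionNumber_eq_top_of_dvd hh hd] at hn
    exact ENat.top_ne_natCast n hn
  have hsubst : PowerSeries.HasSubst l :=
    PowerSeries.HasSubst.of_constantCoeff_zero (not_isUnit_iff.mp hlu)
  let A := Ring2 K ⧸ Ideal.span {h}
  have hdom : IsDomain A := isDomain_quotient hh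
  -- The curve becomes a K[[X]]-algebra through X ↦ l, so the codimension of X is i₀(l, h) = n.
  let φ : PowerSeries K →ₐ[K] A :=
    (Ideal.Quotient.mkₐ K (Ideal.span {h})).comp (PowerSeries.substAlgHom hsubst)
  let : Algebra (PowerSeries K) A := φ.toRingHom.toAlgebra
  have : IsScalarTower K (PowerSeries K) A :=
    IsScalarTower.of_algebraMap_eq fun k => (φ.commutes k).symm
  have hX : algebraMap (PowerSeries K) A PowerSeries.X = Ideal.Quotient.mk _ l := by
    change Ideal.Quotient.mk _ (PowerSeries.substAlgHom hsubst PowerSeries.X) = _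
    rw [PowerSeries.substAlgHom_X]
  have hl0 : Ideal.Quotient.mk (Ideal.span {h}) l ≠ 0 := by
    rwa [Ne, Ideal.Quotient.eq_zero_iff_mem, Ideal.mem_span_singleton]
  have hinj : Function.Injective (algebraMap (PowerSeries K) A) := by
    rw [injective_iff_map_eq_zero]
    intro g hg
    by_contra hg0
    obtain ⟨m, u, rfl⟩ := IsDiscreteValuationRing.eq_unit_mul_pow_irreducible hg0
      PowerSeries.X_prime.irreducible
    rw [map_mul, map_pow, hX, mul_eq_zero] at hg
    exact hg.elim (u.isUnit.map _).ne_zero (pow_ne_zero m hl0)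
  obtain ⟨γ, r, hγ, hpr, hr⟩ := exists_branch (K := K) (A := A) p hinj
    (by rw [hX, isUnit_mk_iff hh.not_isUnit]; exact hlu) (n := n)
    (by rw [hX, ← hn, intersectionNumber_eq_colength]) hpn
  refine ⟨γ.comp (Ideal.Quotient.mkₐ K (Ideal.span {h})), r, hpr, fun g => ?_, fun g => ?_⟩
  · change γ (Ideal.Quotient.mk _ g) = 0 ↔ _
    rw [map_eq_zero_iff _ hγ, Ideal.Quotient.eq_zero_iff_mem, Ideal.mem_span_singleton]
  · rw [intersectionNumber_eq_colength]
    exact hr _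

end IntersectionNumber

/-! ### The polar and its branches -/

section Polar

open MvPowerSeries

variable {K : Type*} [Field K]

theorem span_pair_X_eq_ker_constantCoeff :
    Ideal.span ({X 0, X 1} : Set (Ring2 K)) =
      RingHom.ker (constantCoeff (σ := Fin 2) (R := K)) := by
  refine le_antisymm ?_ fun f hf => ?_
  · rw [Ideal.span_le]
    rintro _ (rfl | rfl) <;> simp [RingHom.mem_ker]
  · obtain ⟨a, b, hab⟩ := exists_eq_C_add_X_mul_add_X_mul f
    rw [RingHom.mem_ker] at hf
    rw [hf, map_zero, zero_add] at hab
    exact Ideal.mem_span_pair.mpr ⟨a, b, by rw [hab]; ring⟩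

theorem intersectionNumber_X_X : intersectionNumber (X 0 : Ring2 K) (X 1) = 1 := by
  let c : Ring2 K →ₐ[K] K :=
    { constantCoeff (σ := Fin 2) (R := K) with
      commutes' := fun k => by simp [MvPowerSeries.algebraMap_apply] }
  have hc : Function.Surjective c := fun k => ⟨C k, by change constantCoeff (C k) = k; simp⟩
  have hker : Ideal.span ({X 0, X 1} : Set (Ring2 K)) = RingHom.ker c :=
    span_pair_X_eq_ker_constantCoeff
  rw [intersectionNumber_eq_vdim, vdim_congr ((Ideal.quotientEquivAlgOfEq K hker).trans
    (Ideal.quotientKerAlgEquivOfSurjective hc)).toLinearEquiv, vdim_eq_finrank]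
  simp

theorem intersectionNumber_eq_of_span_eq {f g f' g' : Ring2 K}
    (h : Ideal.span ({f, g} : Set (Ring2 K)) = Ideal.span {f', g'}) :
    intersectionNumber f g = intersectionNumber f' g' := by
  rw [intersectionNumber_eq_vdim, intersectionNumber_eq_vdim, h]

/-- Write l = x a + y b. Order one forces a or b to be a unit, and then l and the other variable
generate the maximal ideal. -/
theorem isUnit_dx_or_isUnit_dy {l : Ring2 K} (hl : IsRegularParameter l) :
    (IsUnit (dx l) ∧ intersectionNumber (X 1) l = 1) ∨
      (IsUnit (dy l) ∧ intersectionNumber (X 0) l = 1) := by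
  have hl0 : constantCoeff l = 0 := one_le_order_iff_constCoeff_eq_zero.mp (le_of_eq hl.symm)
  obtain ⟨a, b, hab⟩ := exists_eq_C_add_X_mul_add_X_mul l
  rw [hl0, map_zero, zero_add] at hab
  have h01 : pderiv K (1 : Fin 2) (X 0) = 0 := pderiv_X_of_ne (by decide)
  have h10 : pderiv K (0 : Fin 2) (X 1) = 0 := pderiv_X_of_ne (by decide)
  have hdx : constantCoeff (dx l) = constantCoeff a := by
    rw [hab, dx]; simp [Derivation.leibniz, h10]
  have hdy : constantCoeff (dy l) = constantCoeff b := by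
    rw [hab, dy]; simp [Derivation.leibniz, h01]
  have hab' : IsUnit a ∨ IsUnit b := by
    by_contra! h
    rw [not_isUnit_iff_one_le_order, not_isUnit_iff_one_le_order] at h
    have h2 : (2 : ℕ∞) ≤ l.order := by
      rw [hab]
      refine le_trans (le_min ?_ ?_) (min_order_le_add)
      · rw [order_mul, order_X_eq_one]
        exact add_le_add_right h.1 1
      · rw [order_mul, order_X_eq_one]
        exact add_le_add_right h.2 1
    rw [hl] at h2
    exact absurd h2 (by decide)
  rcases hab' with ha | hb
  · refine Or.inl ⟨?_, ?_⟩
    · rwa [isUnit_iff_constantCoeff, hdx, ← isUnit_iff_constantCoeff]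
    · rw [← intersectionNumber_X_X (K := K)]
      refine intersectionNumber_eq_of_span_eq ?_
      obtain ⟨c, hc⟩ := ha.exists_right_inv
      apply le_antisymm <;> rw [Ideal.span_le]
      · rintro _ (rfl | rfl)
        · exact Ideal.subset_span (by simp)
        · exact Ideal.mem_span_pair.mpr ⟨a, b, by rw [hab]; ring⟩
      · rintro _ (rfl | rfl)
        · exact Ideal.mem_span_pair.mpr ⟨-(b * c), c, by rw [hab]; linear_combination X 0 * hc⟩
        · exact Ideal.subset_span (by simp)
  · refine Or.inr ⟨?_, ?_⟩
    · rwa [isUnit_iff_constantCoeff, hdy, ← isUnit_iff_constantCoeff]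
    · rw [← intersectionNumber_X_X (K := K)]
      refine intersectionNumber_eq_of_span_eq ?_
      obtain ⟨c, hc⟩ := hb.exists_right_inv
      apply le_antisymm <;> rw [Ideal.span_le]
      · rintro _ (rfl | rfl)
        · exact Ideal.subset_span (by simp)
        · exact Ideal.mem_span_pair.mpr ⟨a, b, by rw [hab]; ring⟩
      · rintro _ (rfl | rfl)
        · exact Ideal.subset_span (by simp)
        · exact Ideal.mem_span_pair.mpr ⟨-(a * c), c, by rw [hab]; linear_combination X 1 * hc⟩

open PowerSeries in
-- On l = 0 the chain rule gives l_x x' + l_y y' = 0. Eliminating the derivative of the variable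
-- whose partial of l is a unit leaves P times the derivative of the other variable, v.
theorem exists_transversal {l : Ring2 K} (hl : IsRegularParameter l) :
    ∃ v : Ring2 K, intersectionNumber v l = 1 ∧ ∀ γ : Ring2 K →ₐ[K] K⟦X⟧, γ l = 0 →
      ∃ u : K⟦X⟧, IsUnit u ∧ ∀ f, u * d⁄dX K (γ f) = d⁄dX K (γ v) * γ (polar l f) := by
  rcases isUnit_dx_or_isUnit_dy hl with ⟨hu, hv⟩ | ⟨hu, hv⟩
  · refine ⟨_, hv, fun γ hγ => ⟨-γ (dx l), (hu.map γ).neg, fun f => ?_⟩⟩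
    have h := derivative_algHom γ l
    rw [hγ, map_zero] at h
    rw [derivative_algHom γ f, polar, map_sub, map_mul, map_mul]
    linear_combination γ (dx f) * h
  · refine ⟨_, hv, fun γ hγ => ⟨γ (dy l), hu.map γ, fun f => ?_⟩⟩
    have h := derivative_algHom γ l
    rw [hγ, map_zero] at h
    rw [derivative_algHom γ f, polar, map_sub, map_mul, map_mul]
    linear_combination -γ (dy f) * h

open PowerSeries in
-- If l_x is a unit, take w = f_x: then f_y lies in (f_x, P), and l_x (γ f)' = f_x (γ l)' along P =
-- 0. The case of l_y is symmetric.
theorem exists_partial {l : Ring2 K} (hl : IsRegularParameter l) (f : Ring2 K) :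
    ∃ w : Ring2 K, Ideal.span ({dx f, dy f} : Set (Ring2 K)) = Ideal.span {w, polar l f} ∧
      ∀ γ : Ring2 K →ₐ[K] K⟦X⟧, γ (polar l f) = 0 →
        ∃ u : K⟦X⟧, IsUnit u ∧ u * d⁄dX K (γ f) = γ w * d⁄dX K (γ l) := by
  rcases isUnit_dx_or_isUnit_dy hl with ⟨hu, -⟩ | ⟨hu, -⟩
  · refine ⟨dx f, ?_, fun γ hγ => ⟨γ (dx l), hu.map γ, ?_⟩⟩
    · obtain ⟨c, hc⟩ := hu.exists_right_inv
      apply le_antisymm <;> rw [Ideal.span_le]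
      · rintro _ (rfl | rfl)
        · exact Ideal.subset_span (by simp)
        · exact Ideal.mem_span_pair.mpr ⟨dy l * c, -c, by
            rw [polar]; linear_combination dy f * hc⟩
      · rintro _ (rfl | rfl)
        · exact Ideal.subset_span (by simp)
        · exact Ideal.mem_span_pair.mpr ⟨dy l, -dx l, by rw [polar]; ring⟩
    · rw [polar, map_sub, map_mul, map_mul] at hγ
      rw [derivative_algHom γ f, derivative_algHom γ l]
      linear_combination -d⁄dX K (γ (MvPowerSeries.X 1)) * hγ
  · refine ⟨dy f, ?_, fun γ hγ => ⟨γ (dy l), hu.map γ, ?_⟩⟩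
    · obtain ⟨c, hc⟩ := hu.exists_right_inv
      apply le_antisymm <;> rw [Ideal.span_le]
      · rintro _ (rfl | rfl)
        · exact Ideal.mem_span_pair.mpr ⟨dx l * c, c, by
            rw [polar]; linear_combination dx f * hc⟩
        · exact Ideal.subset_span (by simp)
      · rintro _ (rfl | rfl)
        · exact Ideal.subset_span (by simp)
        · exact Ideal.mem_span_pair.mpr ⟨dy l, -dx l, by rw [polar]; ring⟩
    · rw [polar, map_sub, map_mul, map_mul] at hγ
      rw [derivative_algHom γ f, derivative_algHom γ l]
      linear_combination d⁄dX K (γ (MvPowerSeries.X 0)) * hγ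

theorem not_dvd_mul_of_charP (p : ℕ) [CharP K p] {m n : ℕ} (hm : ¬ p ∣ m) :
    p ∣ m * n ↔ p ∣ n := by
  rw [← CharP.cast_eq_zero_iff K p, ← CharP.cast_eq_zero_iff K p, Nat.cast_mul, mul_eq_zero,
    or_iff_right (mt (CharP.cast_eq_zero_iff K p m).mp hm)]

variable [IsAlgClosed K]

/-- Parametrize l itself, using the transversal v with i₀(v, l) = 1, and compare orders in u (γ f)'
= (γ v)' γ(P): both derivatives lose exactly one, as p divides neither r nor r n. -/
theorem intersectionNumber_polar_add_one (p : ℕ) [CharP K p] {l : Ring2 K}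
    (hl : IsRegularParameter l) {f : Ring2 K} {n : ℕ} (hn : intersectionNumber f l = n)
    (hpn : ¬ p ∣ n) : intersectionNumber l (polar l f) + 1 = n := by
  have hlprime : Prime l := (irreducible_of_order_eq_one hl).prime
  have hn0 : n ≠ 0 := by rintro rfl; exact hpn (dvd_zero p)
  obtain ⟨v, hv, hvγ⟩ := exists_transversal hl
  have hp1 : ¬ p ∣ 1 := fun h => CharP.char_ne_one K p (Nat.dvd_one.mp h)
  obtain ⟨γ, r, hpr, hγ0, hγ⟩ := exists_parametrization p hlprime (n := 1) (by simpa using hv) hp1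
  have hr0 : r ≠ 0 := by rintro rfl; exact hpr (dvd_zero p)
  obtain ⟨u, hu, hγf⟩ := hvγ γ ((hγ0 l).mpr dvd_rfl)
  have h1 : (PowerSeries.derivative K (γ v)).order + 1 = r := by
    rw [order_derivative_add_one_eq_iff p (by rw [hγ, hv, mul_one]) hr0]
    exact hpr
  have h2 : (PowerSeries.derivative K (γ f)).order + 1 = (r * n : ℕ) := by
    rw [order_derivative_add_one_eq_iff p (by rw [hγ, hn, Nat.cast_mul]) (mul_ne_zero hr0 hn0),
      not_dvd_mul_of_charP (K := K) p hpr]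
    exact hpn
  have h3 := congrArg PowerSeries.order (hγf f)
  rw [PowerSeries.order_mul, PowerSeries.order_mul, PowerSeries.order_zero_of_unit hu, zero_add,
    hγ (polar l f)] at h3
  rw [h3, add_right_comm, h1] at h2
  rw [intersectionNumber_comm, ← enat_mul_eq_mul_iff hr0, mul_add, mul_one, add_comm, h2,
    Nat.cast_mul]

variable (p : ℕ) [CharP K p] {f l : Ring2 K}

/-- If f = h g, then γ f = 0 while (γ l)' ≠ 0, so h divides w and hence both partials of f.
Squarefreeness gives h ∤ g, so h divides both partials of h, and therefore its own polar. This
contradicts i₀(l, P_l(h)) = i₀(l, h) - 1. -/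
theorem not_dvd_of_dvd_polar (hf : Squarefree f) (hl : IsRegularParameter l)
    {h : Ring2 K} (hh : Prime h) (hP : h ∣ polar l f)
    (hlh : NotCongrZero p (intersectionNumber l h)) : ¬ h ∣ f := by
  rintro ⟨g, rfl⟩
  obtain ⟨n, hn, hpn⟩ := notCongrZero_iff.mp hlh
  have hn0 : n ≠ 0 := by rintro rfl; exact hpn (dvd_zero p)
  obtain ⟨γ, r, hpr, hγ0, hγ⟩ := exists_parametrization p hh hn hpn
  have hr0 : r ≠ 0 := by rintro rfl; exact hpr (dvd_zero p)
  obtain ⟨w, hspan, hw⟩ := exists_partial hl (h * g)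
  obtain ⟨u, hu, hγf⟩ := hw γ ((hγ0 _).mpr hP)
  rw [(hγ0 _).mpr (dvd_mul_right h g), map_zero, mul_zero, eq_comm, mul_eq_zero, hγ0] at hγf
  have hl' : PowerSeries.derivative K (γ l) ≠ 0 := by
    intro h0
    have := (order_derivative_add_one_eq_iff p (g := γ l) (n := r * n)
      (by rw [hγ, hn, Nat.cast_mul]) (mul_ne_zero hr0 hn0)).mpr
      (by rwa [not_dvd_mul_of_charP (K := K) p hpr])
    rw [h0, PowerSeries.order_zero, top_add] at this
    exact ENat.top_ne_natCast _ this
  have hhw : h ∣ w := hγf.resolve_right hl'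
  have hle : Ideal.span ({dx (h * g), dy (h * g)} : Set (Ring2 K)) ≤ Ideal.span {h} := by
    rw [hspan, Ideal.span_le]
    rintro _ (rfl | rfl)
    · exact Ideal.mem_span_singleton.mpr hhw
    · exact Ideal.mem_span_singleton.mpr hP
  have hhg : ¬ h ∣ g := fun hd => hh.not_isUnit (hf h (mul_dvd_mul_left h hd))
  have hx : h ∣ dx h := by
    have h1 : h ∣ dx (h * g) := Ideal.mem_span_singleton.mp (hle (Ideal.subset_span (by simp)))
    rw [dx, Derivation.leibniz, smul_eq_mul, smul_eq_mul, dvd_add_right (dvd_mul_right _ _)] at h1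
    exact (hh.dvd_or_dvd h1).resolve_left hhg
  have hy : h ∣ dy h := by
    have h1 : h ∣ dy (h * g) := Ideal.mem_span_singleton.mp (hle (Ideal.subset_span (by simp)))
    rw [dy, Derivation.leibniz, smul_eq_mul, smul_eq_mul, dvd_add_right (dvd_mul_right _ _)] at h1
    exact (hh.dvd_or_dvd h1).resolve_left hhg
  have h2 := intersectionNumber_polar_add_one p hl ((intersectionNumber_comm h l).trans hn) hpn
  have h3 : intersectionNumber l h ≤ intersectionNumber l (polar l h) :=
    intersectionNumber_le_of_dvd l
      (dvd_sub (Dvd.dvd.mul_right hx _) (Dvd.dvd.mul_right hy _))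
  rw [← h2] at hn
  rw [hn] at h3
  have hfin : intersectionNumber l (polar l h) ≠ ⊤ := fun ht => by
    rw [ht, top_add] at h2
    exact ENat.top_ne_natCast _ h2
  exact absurd h3 (not_le.mpr ((ENat.lt_add_one_iff hfin).mpr le_rfl))

/-- The comparison of intersection numbers along a single branch of the polar. -/
theorem intersectionNumber_le_of_dvd_polar (hf : Squarefree f) (hfu : ¬ IsUnit f)
    (hl : IsRegularParameter l) {w : Ring2 K}
    (hw : ∀ γ : Ring2 K →ₐ[K] PowerSeries K, γ (polar l f) = 0 →
      ∃ u, IsUnit u ∧ u * PowerSeries.derivative K (γ f) = γ w * PowerSeries.derivative K (γ l))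
    {h : Ring2 K} (hh : Prime h) (hP : h ∣ polar l f)
    (hlh : NotCongrZero p (intersectionNumber l h)) :
    intersectionNumber f h ≠ ⊤ ∧
      intersectionNumber f h ≤ intersectionNumber w h + intersectionNumber l h ∧
      (intersectionNumber f h = intersectionNumber w h + intersectionNumber l h ↔
        NotCongrZero p (intersectionNumber f h)) := by
  have hndvd := not_dvd_of_dvd_polar p hf hl hh hP hlh
  obtain ⟨n, hn, hpn⟩ := notCongrZero_iff.mp hlh
  have hn0 : n ≠ 0 := by rintro rfl; exact hpn (dvd_zero p)
  obtain ⟨γ, r, hpr, hγ0, hγ⟩ := exists_parametrization p hh hn hpn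
  have hr0 : r ≠ 0 := by rintro rfl; exact hpr (dvd_zero p)
  obtain ⟨u, hu, hγf⟩ := hw γ ((hγ0 _).mpr hP)
  have hfin : intersectionNumber f h ≠ ⊤ := by
    intro ht
    have := hγ f
    rw [ht, ENat.mul_top (Nat.cast_ne_zero.mpr hr0), PowerSeries.order_eq_top, hγ0] at this
    exact hndvd this
  obtain ⟨a, ha⟩ := ENat.ne_top_iff_exists.mp hfin
  have ha0 : a ≠ 0 := by
    rintro rfl
    exact hfu ((intersectionNumber_eq_zero_iff hh.not_isUnit).mp (by rw [← ha]; rfl))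
  have hl' : (PowerSeries.derivative K (γ l)).order + 1 = (r * n : ℕ) :=
    (order_derivative_add_one_eq_iff p (by rw [hγ, hn, Nat.cast_mul])
      (mul_ne_zero hr0 hn0)).mpr (by rwa [not_dvd_mul_of_charP (K := K) p hpr])
  -- Orders in u (γ f)' = γ(w) (γ l)', with the one lost by γ l restored.
  have hord : (PowerSeries.derivative K (γ f)).order + 1 =
      r * (intersectionNumber w h + intersectionNumber l h) := by
    have h3 := congrArg PowerSeries.order hγf
    rw [PowerSeries.order_mul, PowerSeries.order_mul, PowerSeries.order_zero_of_unit hu, zero_add,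
      hγ w] at h3
    rw [h3, add_assoc, hl', mul_add, hn, Nat.cast_mul]
  have hfa : (γ f).order = (r * a : ℕ) := by rw [hγ, ← ha, Nat.cast_mul]
  refine ⟨hfin, ?_, ?_⟩
  · rw [← enat_mul_le_mul_iff hr0, ← hord, ← hγ]
    exact order_le_order_derivative_add_one _
  · have key := order_derivative_add_one_eq_iff p hfa (mul_ne_zero hr0 ha0)
    rw [hord, not_dvd_mul_of_charP (K := K) p hpr, Nat.cast_mul, enat_mul_eq_mul_iff hr0, ha,
      eq_comm] at key
    rw [key, notCongrZero_iff, ← ha]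
    constructor
    · exact fun h => ⟨a, rfl, h⟩
    · rintro ⟨m, hm, hpm⟩
      rwa [Nat.cast_injective hm]

end Polar

end PlaneCurve

/-! ### Summation over the branches of the polar -/

open PlaneCurve

theorem proposition2p3 {K : Type*} [Field K] [IsAlgClosed K] (p : ℕ) [CharP K p]
    (f l : PlaneCurve.Ring2 K)
    (hf : Squarefree f)
    (hl : PlaneCurve.IsRegularParameter l)
    (hlf : ¬ l ∣ f)
    (hfl : PlaneCurve.NotCongrZero p (PlaneCurve.intersectionNumber f l))
    (hlh : ∀ h : PlaneCurve.Ring2 K, Irreducible h → h ∣ PlaneCurve.polar l f →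
      PlaneCurve.NotCongrZero p (PlaneCurve.intersectionNumber l h)) :
    PlaneCurve.intersectionNumber f (PlaneCurve.polar l f) ≤
        PlaneCurve.milnorNumber f + PlaneCurve.intersectionNumber f l - 1 ∧
      (PlaneCurve.intersectionNumber f (PlaneCurve.polar l f) =
          PlaneCurve.milnorNumber f + PlaneCurve.intersectionNumber f l - 1 ↔
        ∀ h : PlaneCurve.Ring2 K, Irreducible h → h ∣ PlaneCurve.polar l f →
          PlaneCurve.NotCongrZero p (PlaneCurve.intersectionNumber f h)) := by
  have hlprime : Prime l := (irreducible_of_order_eq_one hl).prime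
  obtain ⟨n, hn, hpn⟩ := notCongrZero_iff.mp hfl
  have hn0 : n ≠ 0 := by rintro rfl; exact hpn (dvd_zero p)
  have hlP : intersectionNumber l (polar l f) + 1 = n :=
    intersectionNumber_polar_add_one p hl hn hpn
  have hfu : ¬ IsUnit f := by
    rw [← intersectionNumber_eq_zero_iff hlprime.not_isUnit, hn]
    exact_mod_cast hn0
  have hP0 : polar l f ≠ 0 := fun h0 => by
    rw [h0, intersectionNumber_comm, intersectionNumber_eq_top_of_dvd hlprime (dvd_zero l),
      top_add] at hlP
    exact ENat.top_ne_natCast _ hlP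
  obtain ⟨w, hspan, hw⟩ := exists_partial hl f
  obtain ⟨s, hs, hsP⟩ := UniqueFactorizationMonoid.exists_prime_factors (polar l f) hP0
  have hsdvd : ∀ h ∈ s, h ∣ polar l f := fun h hh =>
    (Multiset.dvd_prod hh).trans hsP.dvd
  have hloc := fun h (hh : h ∈ s) => intersectionNumber_le_of_dvd_polar p hf hfu hl hw (hs h hh)
    (hsdvd h hh) (hlh h (hs h hh).irreducible (hsdvd h hh))
  have hsum : ∀ g, intersectionNumber g (polar l f) =
      (s.map fun h => intersectionNumber g h).sum := fun g => by
    rw [← intersectionNumber_eq_of_associated g hsP, intersectionNumber_multiset_prod g s hs]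
  -- Since i₀(f, l) = i₀(l, P) + 1, the truncated subtraction removes a genuine 1, even if μ(f) = ⊤.
  have hrhs : milnorNumber f + intersectionNumber f l - 1 =
      (s.map fun h => intersectionNumber w h + intersectionNumber l h).sum := by
    have hμ : milnorNumber f = intersectionNumber w (polar l f) := by
      rw [milnorNumber, hspan, intersectionNumber]
    rw [Multiset.sum_map_add, ← hsum, ← hsum, hμ, hn, ← hlP, ← add_assoc]
    exact (ENat.addLECancellable_of_ne_top ENat.one_ne_top).add_tsub_cancel_right
  rw [hrhs, hsum f]
  refine ⟨Multiset.sum_map_le_sum_map _ _ fun h hh => (hloc h hh).2.1, ?_⟩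
  rw [multiset_sum_eq_sum_iff s _ _ (fun h hh => (hloc h hh).2.1) fun h hh => (hloc h hh).1]
  constructor
  · intro H h hirr hdvd
    -- An arbitrary irreducible factor is associated to one in the chosen factorization, with the
    -- same intersection numbers.
    obtain ⟨h', hh', hdvd'⟩ := hirr.prime.exists_mem_multiset_dvd (hdvd.trans hsP.symm.dvd)
    have hassoc : Associated h h' := hirr.prime.associated_of_dvd (hs h' hh') hdvd'
    rw [intersectionNumber_eq_of_associated f hassoc]
    exact (hloc h' hh').2.2.mp (H h' hh')
  · exact fun H h hh => (hloc h hh).2.2.mpr (H h (hs h hh).irreducible (hsdvd h hh))
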